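/- For a form $F \in \mathbb{C}[x_1,\dots,x_n]$ of degree $d$, let the Waring rank $r(F)$ be the least $r$ such that $F = c_1\ell_1^d + \dots + c_r\ell_r^d$ for some linear forms $\ell_1,\dots,\ell_r$ and scalars $c_1,\dots,c_r\in\mathbb{C}$, and let $r_{\max}(n,d)$ be the maximum of $r(F)$ over all forms $F$ of degree $d$ in $n$ variables over $\mathbb{C}$. Theorem. Let $d \ge 3$ be odd. The maximum of the Waring ranks of the monomials of degree $d$ in $3$ variables is $((d+1)/2)^2$, and there exist forms of degree $d$ in $3$ variables whose Waring rank is strictly greater than $((d+1)/2)^2$. The maximum $r_{\max}(3,d)$ exists (it is attained), and $$r_{\max}(3,d) > \left(\frac{d+1}{2}\right)^2.$$ -/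

import Mathlib

open MvPolynomial

/-- The Waring rank of a form `F` of degree `d` in `n` variables over `ℂ`: the least number `r` such
that `F = c₁ ℓ₁ ^ d + ⋯ + cᵣ ℓᵣ ^ d` for some scalars `cᵢ` and linear forms `ℓᵢ`. (Over `ℂ` every
form of degree `d` has such a presentation, so the infimum is over a non-empty set; a value `> 0`
is attained in any case.) -/
noncomputable def waringRank {n : ℕ} (d : ℕ) (F : MvPolynomial (Fin n) ℂ) : ℕ :=
  sInf {r : ℕ | ∃ (c : Fin r → ℂ) (l : Fin r → MvPolynomial (Fin n) ℂ),
    (∀ i, (l i).IsHomogeneous 1) ∧ F = ∑ i, c i • l i ^ d}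

/-- The set of Waring ranks of all forms of degree `d` in `n` variables. -/
def waringRanks (n d : ℕ) : Set ℕ :=
  {r : ℕ | ∃ F : MvPolynomial (Fin n) ℂ, F.IsHomogeneous d ∧ waringRank d F = r}

/-- The set of Waring ranks of all monomials of degree `d` in `n` variables. -/
def monomialWaringRanks (n d : ℕ) : Set ℕ :=
  {r : ℕ | ∃ m : Fin n →₀ ℕ, m.degree = d ∧
    waringRank d (monomial m (1 : ℂ)) = r}

/-- The maximum Waring rank `r_max(n, d)` of forms of degree `d` in `n` variables. -/
noncomputable def maxWaringRank (n d : ℕ) : ℕ :=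
  sSup (waringRanks n d)

/-! Write `d = 2 * b + 3`. Averaging over roots of unity gives every monomial length at most `(b +
2) ^ 2`; hence all ranks are bounded and the maximum is attained. For lower bounds, split a
decomposition into forms `x + V y + W z` (set `A`) and forms without `x` (set `B`). Coefficients
divisible by `x` prescribe the moments `∑ C V^j W^k` over `A` with `j + k < d`; `B` affects only
those with `j + k = d`. Moments that pair monomials triangularly make these monomials independent as
functions on `A`, which bounds `A.card` below (`card_le_card_of_triangular`). For `x y^(b+1)
z^(b+1)` a square of monomials gives the sharp bound. For `highRankForm b` a box gives `A.card ≥ (b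
+ 3) * (b + 1) = (b + 2) ^ 2 - 1`, so length at most `(b + 2) ^ 2` forces `B.card ≤ 1`. The term `y
z^(2b+2)` excludes both cases: if `B` is empty, two further monomials are independent on `A`; a
single form in `B` either leaves a top moment on `A` that adds one monomial, or would have to
produce `y z^(d-1)` without `z^d`. -/

/-- `F` is a combination of `r` powers of degree `d` of linear forms. -/
def HasWaringLength {n : ℕ} (d : ℕ) (F : MvPolynomial (Fin n) ℂ) (r : ℕ) : Prop :=
  ∃ (c : Fin r → ℂ) (l : Fin r → MvPolynomial (Fin n) ℂ),
    (∀ i, (l i).IsHomogeneous 1) ∧ F = ∑ i, c i • l i ^ d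

/-! ### Calculus of Waring lengths -/

namespace HasWaringLength

variable {n d : ℕ} {F G : MvPolynomial (Fin n) ℂ} {r s : ℕ}

lemma of_fintype {ι : Type*} [Fintype ι] (c : ι → ℂ) (p : ι → Fin n → ℂ)
    (h : F = ∑ i, c i • (∑ j, p i j • X j) ^ d) : HasWaringLength d F (Fintype.card ι) := by
  refine ⟨fun i => c ((Fintype.equivFin ι).symm i),
    fun i => ∑ j, p ((Fintype.equivFin ι).symm i) j • X j, fun i => ?_, ?_⟩
  · refine IsHomogeneous.sum _ _ _ fun j _ => ?_
    rw [smul_eq_C_mul]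
    exact isHomogeneous_C_mul_X _ _
  · rw [h]
    exact ((Fintype.equivFin ι).symm.sum_comp
      (fun i => c i • (∑ j, p i j • (X j : MvPolynomial (Fin n) ℂ)) ^ d)).symm

lemma waringRank_le (h : HasWaringLength d F r) : waringRank d F ≤ r := Nat.sInf_le h

lemma waringRank_self (h : HasWaringLength d F r) : HasWaringLength d F (waringRank d F) :=
  Nat.sInf_mem (s := {r | HasWaringLength d F r}) ⟨r, h⟩

lemma zero : HasWaringLength d (0 : MvPolynomial (Fin n) ℂ) 0 :=
  ⟨Fin.elim0, Fin.elim0, fun i => i.elim0, by simp⟩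

lemma add (hF : HasWaringLength d F r) (hG : HasWaringLength d G s) :
    HasWaringLength d (F + G) (r + s) := by
  obtain ⟨c, l, hl, rfl⟩ := hF
  obtain ⟨c', l', hl', rfl⟩ := hG
  refine ⟨Fin.append c c', Fin.append l l', fun i => ?_, ?_⟩
  · induction i using Fin.addCases <;> simp [hl, hl']
  · simp [Fin.sum_univ_add]

lemma smul (a : ℂ) (hF : HasWaringLength d F r) : HasWaringLength d (a • F) r := by
  obtain ⟨c, l, hl, rfl⟩ := hF
  exact ⟨fun i => a * c i, l, hl, by simp [Finset.smul_sum, mul_smul]⟩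

lemma mono (hF : HasWaringLength d F r) (h : r ≤ s) : HasWaringLength d F s := by
  obtain ⟨k, rfl⟩ := Nat.exists_eq_add_of_le h
  have h0 : HasWaringLength d (0 : MvPolynomial (Fin n) ℂ) k :=
    ⟨0, 0, fun _ => isHomogeneous_zero _ _ _, by simp⟩
  simpa using hF.add h0

lemma sum {κ : Type*} (s : Finset κ) (f : κ → MvPolynomial (Fin n) ℂ)
    (h : ∀ k ∈ s, HasWaringLength d (f k) r) : HasWaringLength d (∑ k ∈ s, f k) (s.card * r) := by
  classical
  induction s using Finset.induction_on with
  | empty => simpa using zero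
  | insert a s ha ih =>
    rw [Finset.sum_insert ha, Finset.card_insert_of_notMem ha, add_mul, one_mul, add_comm]
    exact (ih fun k hk => h k (Finset.mem_insert_of_mem hk)).add (h a (Finset.mem_insert_self a s))

end HasWaringLength

/-! ### Coefficients of power sums -/

lemma sum_smul_X_eq_of_isHomogeneous_one {n : ℕ} {l : MvPolynomial (Fin n) ℂ}
    (hl : l.IsHomogeneous 1) : l = ∑ j, coeff (Finsupp.single j 1) l • X j := by
  ext m
  rw [coeff_sum]
  simp only [coeff_smul, coeff_X, smul_eq_mul, mul_ite, mul_one, mul_zero]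
  by_cases hm : m.degree = 1
  · obtain ⟨j, rfl⟩ := (Finsupp.sum_eq_one_iff m).1 hm
    simp [Finsupp.single_left_inj]
  · rw [hl.coeff_eq_zero hm]
    refine (Finset.sum_eq_zero fun j _ => if_neg ?_).symm
    rintro rfl
    simp at hm

lemma coeff_sum_smul_pow {n d : ℕ} {ι : Type*} [Fintype ι] (c : ι → ℂ) (p : ι → Fin n → ℂ)
    {m : Fin n →₀ ℕ} (hm : m.degree = d) :
    coeff m (∑ i, c i • (∑ j, p i j • X j) ^ d : MvPolynomial (Fin n) ℂ) =
      m.multinomial * ∑ i, c i * ∏ j, p i j ^ m j := by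
  have hm' : m.sum (fun _ k => k) = d := hm
  rw [coeff_sum, Finset.mul_sum]
  refine Finset.sum_congr rfl fun i _ => ?_
  rw [coeff_smul, coeff_linearCombination_X_pow_of_fintype, if_pos hm',
    Finsupp.prod_fintype _ _ (by simp), smul_eq_mul]
  ring

lemma coeff_sum_smul_pow_eq_zero {n d : ℕ} {ι : Type*} [Fintype ι] (c : ι → ℂ)
    (p : ι → Fin n → ℂ) {m : Fin n →₀ ℕ} (hm : m.degree ≠ d) :
    coeff m (∑ i, c i • (∑ j, p i j • X j) ^ d : MvPolynomial (Fin n) ℂ) = 0 := by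
  have hm' : m.sum (fun _ k => k) ≠ d := hm
  rw [coeff_sum]
  refine Finset.sum_eq_zero fun i _ => ?_
  rw [coeff_smul, coeff_linearCombination_X_pow_of_fintype, if_neg hm', smul_zero]

lemma multinomial_cast_ne_zero {n : ℕ} (m : Fin n →₀ ℕ) : (m.multinomial : ℂ) ≠ 0 := by
  rw [Finsupp.multinomial_eq]
  exact_mod_cast (Nat.multinomial_pos _ _).ne'

/-- A monomial is a combination of powers as soon as the corresponding weighted sum of the values
of the monomials at the coefficient vectors singles it out. -/
lemma hasWaringLength_monomial {n d : ℕ} {ι : Type*} [Fintype ι] (c : ι → ℂ) (p : ι → Fin n → ℂ)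
    (m : Fin n →₀ ℕ) (hm : m.degree = d) (hne : ∑ i, c i * ∏ j, p i j ^ m j ≠ 0)
    (hz : ∀ m' : Fin n →₀ ℕ, m'.degree = d → m' ≠ m → ∑ i, c i * ∏ j, p i j ^ m' j = 0) :
    HasWaringLength d (monomial m (1 : ℂ)) (Fintype.card ι) := by
  have key : monomial m (1 : ℂ) = (m.multinomial * ∑ i, c i * ∏ j, p i j ^ m j : ℂ)⁻¹ •
      ∑ i, c i • (∑ j, p i j • X j) ^ d := by
    ext m'
    rw [coeff_smul, coeff_monomial]
    by_cases hd : m'.degree = d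
    · rw [coeff_sum_smul_pow c p hd]
      split_ifs with h
      · subst h
        exact (inv_mul_cancel₀ (mul_ne_zero (multinomial_cast_ne_zero m) hne)).symm
      · rw [hz m' hd (Ne.symm h), mul_zero, smul_zero]
    · rw [coeff_sum_smul_pow_eq_zero c p hd, if_neg, smul_zero]
      rintro rfl
      exact hd hm
  rw [key]
  exact (HasWaringLength.of_fintype c p rfl).smul _

/-! ### Upper bounds from roots of unity -/

lemma IsPrimitiveRoot.sum_pow_mul {k : ℕ} {ζ : ℂ} (hζ : IsPrimitiveRoot ζ k) (e : ℕ) :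
    ∑ i : Fin k, ζ ^ (i * e : ℕ) = if k ∣ e then (k : ℂ) else 0 := by
  have h1 : ∀ i : Fin k, ζ ^ (i * e : ℕ) = (ζ ^ e) ^ (i : ℕ) := fun i => by
    rw [mul_comm, pow_mul]
  simp only [h1]
  rw [Fin.sum_univ_eq_sum_range (fun i => (ζ ^ e) ^ i)]
  split_ifs with h
  · simp [(hζ.pow_eq_one_iff_dvd e).2 h]
  · have h2 : ζ ^ e ≠ 1 := fun h' => h ((hζ.pow_eq_one_iff_dvd e).1 h')
    rw [geom_sum_eq h2, ← pow_mul, mul_comm, pow_mul, hζ.pow_eq_one]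
    simp

lemma Fin.univ_eq_of_three_ne : ∀ {p q r : Fin 3}, p ≠ q → p ≠ r → q ≠ r →
    (Finset.univ : Finset (Fin 3)) = {p, q, r} := by
  decide

lemma Fin.prod_univ_of_three_ne {M : Type*} [CommMonoid M] {p q r : Fin 3} (hpq : p ≠ q)
    (hpr : p ≠ r) (hqr : q ≠ r) (f : Fin 3 → M) : ∏ j, f j = f p * f q * f r := by
  rw [Fin.univ_eq_of_three_ne hpq hpr hqr, Finset.prod_insert (by simp [hpq, hpr]),
    Finset.prod_insert (by simp [hqr]), Finset.prod_singleton, mul_assoc]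

lemma Finsupp.degree_of_three_ne {p q r : Fin 3} (hpq : p ≠ q)
    (hpr : p ≠ r) (hqr : q ≠ r) (m : Fin 3 →₀ ℕ) : m.degree = m p + m q + m r := by
  rw [Finsupp.degree_eq_sum, Fin.univ_eq_of_three_ne hpq hpr hqr,
    Finset.sum_insert (by simp [hpq, hpr]),
    Finset.sum_insert (by simp [hqr]), Finset.sum_singleton, add_assoc]

lemma Finsupp.ext_of_three_ne {p q r : Fin 3} (hpq : p ≠ q) (hpr : p ≠ r) (hqr : q ≠ r)
    {m m' : Fin 3 →₀ ℕ} (h1 : m p = m' p) (h2 : m q = m' q) (h3 : m r = m' r) : m = m' := by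
  ext j
  have : j ∈ ({p, q, r} : Finset (Fin 3)) := by
    rw [← Fin.univ_eq_of_three_ne hpq hpr hqr]; exact Finset.mem_univ j
  simp only [Finset.mem_insert, Finset.mem_singleton] at this
  rcases this with rfl | rfl | rfl <;> assumption

lemma succ_dvd_succ_cases {a b : ℕ} (h : a + 1 ∣ b + 1) : b = a ∨ 2 * a + 1 ≤ b := by
  obtain ⟨k, hk⟩ := h
  rcases k with _ | _ | k
  · simp at hk
  · left; simpa using hk
  · right; nlinarith

/-- The characters select exponents congruent to those of `m` modulo `m q + 1` and `m r + 1`. Any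
other such exponent exceeds its value in `m` by at least `m q + 1` or `m r + 1`, more than the `m p`
that the degree leaves available. -/
lemma hasWaringLength_monomial_mul {p q r : Fin 3} (hpq : p ≠ q) (hpr : p ≠ r) (hqr : q ≠ r)
    (m : Fin 3 →₀ ℕ) (h1 : m p ≤ m q) (h2 : m p ≤ m r) :
    HasWaringLength m.degree (monomial m (1 : ℂ)) ((m q + 1) * (m r + 1)) := by
  obtain ⟨ζ, hζ⟩ : ∃ ζ : ℂ, IsPrimitiveRoot ζ (m q + 1) :=
    ⟨_, Complex.isPrimitiveRoot_exp _ (Nat.succ_ne_zero _)⟩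
  obtain ⟨ξ, hξ⟩ : ∃ ξ : ℂ, IsPrimitiveRoot ξ (m r + 1) :=
    ⟨_, Complex.isPrimitiveRoot_exp _ (Nat.succ_ne_zero _)⟩
  have key : ∀ m' : Fin 3 →₀ ℕ, ∑ i : Fin (m q + 1) × Fin (m r + 1),
      (ζ ^ (i.1 : ℕ) * ξ ^ (i.2 : ℕ)) *
        ∏ j, (if j = q then ζ ^ (i.1 : ℕ) else if j = r then ξ ^ (i.2 : ℕ) else 1) ^ m' j =
      (if m q + 1 ∣ m' q + 1 then ((m q + 1 : ℕ) : ℂ) else 0) *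
        (if m r + 1 ∣ m' r + 1 then ((m r + 1 : ℕ) : ℂ) else 0) := by
    intro m'
    rw [← hζ.sum_pow_mul, ← hξ.sum_pow_mul, Finset.sum_mul_sum, Fintype.sum_prod_type]
    refine Finset.sum_congr rfl fun i _ => Finset.sum_congr rfl fun j _ => ?_
    rw [Fin.prod_univ_of_three_ne hpq hpr hqr]
    simp only [if_neg hpq, if_neg hpr, if_neg hqr.symm, if_true]
    ring
  have := hasWaringLength_monomial
    (fun i : Fin (m q + 1) × Fin (m r + 1) => ζ ^ (i.1 : ℕ) * ξ ^ (i.2 : ℕ))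
    (fun i j => if j = q then ζ ^ (i.1 : ℕ) else if j = r then ξ ^ (i.2 : ℕ) else 1) m rfl ?_ ?_
  · simpa using this
  · rw [key]
    simp only [dvd_refl, if_true]
    exact mul_ne_zero (Nat.cast_ne_zero.2 (Nat.succ_ne_zero _))
      (Nat.cast_ne_zero.2 (Nat.succ_ne_zero _))
  · intro m' hm' hne
    rw [key]
    rw [Finsupp.degree_of_three_ne hpq hpr hqr, Finsupp.degree_of_three_ne hpq hpr hqr] at hm'
    split_ifs with h3 h4
    · have h5 := succ_dvd_succ_cases h3
      have h6 := succ_dvd_succ_cases h4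
      exact (hne (Finsupp.ext_of_three_ne hpq hpr hqr (by omega) (by omega) (by omega))).elim
    all_goals simp

lemma hasWaringLength_monomial_of_eq_zero {p q r : Fin 3} (hpq : p ≠ q) (hpr : p ≠ r)
    (hqr : q ≠ r) (m : Fin 3 →₀ ℕ) (h1 : m p = 0) (h2 : m q ≤ m r) :
    HasWaringLength m.degree (monomial m (1 : ℂ)) (m r + 1) := by
  obtain ⟨ξ, hξ⟩ : ∃ ξ : ℂ, IsPrimitiveRoot ξ (m r + 1) :=
    ⟨_, Complex.isPrimitiveRoot_exp _ (Nat.succ_ne_zero _)⟩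
  have key : ∀ m' : Fin 3 →₀ ℕ, ∑ i : Fin (m r + 1), ξ ^ (i : ℕ) *
        ∏ j, (if j = p then 0 else if j = r then ξ ^ (i : ℕ) else 1) ^ m' j =
      0 ^ m' p * (if m r + 1 ∣ m' r + 1 then ((m r + 1 : ℕ) : ℂ) else 0) := by
    intro m'
    rw [← hξ.sum_pow_mul, Finset.mul_sum]
    refine Finset.sum_congr rfl fun i _ => ?_
    rw [Fin.prod_univ_of_three_ne hpq hpr hqr]
    simp only [if_neg hpq.symm, if_neg hpr.symm, if_neg hqr, if_true]
    ring
  have := hasWaringLength_monomial (fun i : Fin (m r + 1) => ξ ^ (i : ℕ))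
    (fun i j => if j = p then 0 else if j = r then ξ ^ (i : ℕ) else 1) m rfl ?_ ?_
  · simpa using this
  · rw [key, h1]
    simp only [dvd_refl, if_true, pow_zero, one_mul]
    exact Nat.cast_ne_zero.2 (Nat.succ_ne_zero _)
  · intro m' hm' hne
    rw [key]
    rw [Finsupp.degree_of_three_ne hpq hpr hqr, Finsupp.degree_of_three_ne hpq hpr hqr] at hm'
    by_cases h3 : m' p = 0
    · split_ifs with h4
      · have h6 := succ_dvd_succ_cases h4
        exact (hne (Finsupp.ext_of_three_ne hpq hpr hqr (by omega) (by omega) (by omega))).elim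
      · simp
    · simp [h3]

lemma exists_sorting (m : Fin 3 → ℕ) :
    ∃ p q r : Fin 3, p ≠ q ∧ p ≠ r ∧ q ≠ r ∧ m p ≤ m q ∧ m q ≤ m r := by
  have h := Tuple.monotone_sort m
  have hinj := (Tuple.sort m).injective
  exact ⟨Tuple.sort m 0, Tuple.sort m 1, Tuple.sort m 2, hinj.ne (by decide), hinj.ne (by decide),
    hinj.ne (by decide), h (by decide), h (by decide)⟩

lemma hasWaringLength_monomial_three {a : ℕ} (ha : 1 ≤ a) (m : Fin 3 →₀ ℕ)
    (hm : m.degree = 2 * a + 1) :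
    HasWaringLength (2 * a + 1) (monomial m (1 : ℂ)) ((a + 1) ^ 2) := by
  obtain ⟨p, q, r, hpq, hpr, hqr, h1, h2⟩ := exists_sorting m
  have hdeg := Finsupp.degree_of_three_ne hpq hpr hqr m
  rw [← hm]
  by_cases h0 : m p = 0
  · refine (hasWaringLength_monomial_of_eq_zero hpq hpr hqr m h0 h2).mono ?_
    have : m r ≤ 2 * a + 1 := by omega
    nlinarith
  · refine (hasWaringLength_monomial_mul hpq hpr hqr m h1 (h1.trans h2)).mono ?_
    -- Since `m p ≥ 1`; the arithmetic-geometric mean inequality then bounds the product.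
    have h3 : m q + m r ≤ 2 * a := by omega
    zify at h3 ⊢
    nlinarith [sq_nonneg ((m q : ℤ) - m r)]

/-- The Waring lengths of the ternary forms of a fixed odd degree are bounded. -/
lemma exists_hasWaringLength_bound {a : ℕ} (ha : 1 ≤ a) :
    ∃ N, ∀ F : MvPolynomial (Fin 3) ℂ, F.IsHomogeneous (2 * a + 1) →
      HasWaringLength (2 * a + 1) F N := by
  refine ⟨(Finset.finsuppAntidiag (Finset.univ : Finset (Fin 3)) (2 * a + 1)).card * (a + 1) ^ 2,
    fun F hF => ?_⟩
  have hsub : F.support ⊆ Finset.finsuppAntidiag Finset.univ (2 * a + 1) := by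
    intro m hm
    rw [Finset.mem_finsuppAntidiag]
    refine ⟨?_, Finset.subset_univ _⟩
    rw [← Finsupp.degree_eq_sum, Finsupp.degree_eq_weight_one]
    exact hF (mem_support_iff.1 hm)
  have h := HasWaringLength.sum (d := 2 * a + 1) (r := (a + 1) ^ 2) F.support
    (fun m => monomial m (coeff m F)) fun m hm => by
      have h1 : monomial m (coeff m F) = coeff m F • monomial m (1 : ℂ) := by
        rw [smul_monomial, smul_eq_mul, mul_one]
      rw [h1]
      refine (hasWaringLength_monomial_three ha m ?_).smul _
      rw [Finsupp.degree_eq_weight_one]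
      exact hF (mem_support_iff.1 hm)
  rw [← as_sum] at h
  exact h.mono (Nat.mul_le_mul_right _ (Finset.card_le_card hsub))

/-! ### Lower bounds from moments -/

/-- In a linear relation among the `f e` on `A`, pairing with `g e` for an `e` of largest `deg` in
its support isolates the coefficient of `e`, so the `f e` are independent in `A → ℂ`. -/
lemma card_le_card_of_triangular {κ ι : Type*} (E : Finset κ) (A : Finset ι) (deg : κ → ℕ)
    (f g : κ → ι → ℂ) (hne : ∀ e ∈ E, ∑ i ∈ A, g e i * f e i ≠ 0)
    (hz : ∀ e ∈ E, ∀ e' ∈ E, e' ≠ e → deg e' ≤ deg e → ∑ i ∈ A, g e i * f e' i = 0) :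
    E.card ≤ A.card := by
  classical
  have hli : LinearIndependent ℂ (fun (e : E) (i : A) => f e i) := by
    rw [Fintype.linearIndependent_iff]
    intro a ha
    by_contra! hcon
    obtain ⟨e, he, hmax⟩ := Finset.exists_max_image (Finset.univ.filter fun e => a e ≠ 0)
      (fun e => deg e) (by obtain ⟨e, he⟩ := hcon; exact ⟨e, by simpa using he⟩)
    have h1 : ∑ e' : E, a e' * ∑ i ∈ A, g e i * f e' i = 0 := by
      have h2 : ∀ i ∈ A, ∑ e' : E, a e' * f e' i = 0 := fun i hi => by
        simpa using congrFun ha ⟨i, hi⟩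
      simp only [Finset.mul_sum]
      rw [Finset.sum_comm]
      refine Finset.sum_eq_zero fun i hi => ?_
      rw [← mul_zero (g e i), ← h2 i hi, Finset.mul_sum]
      exact Finset.sum_congr rfl fun _ _ => by ring
    rw [Finset.sum_eq_single e] at h1
    · rcases mul_eq_zero.1 h1 with h | h
      · exact (Finset.mem_filter.1 he).2 h
      · exact hne e e.2 h
    · intro e' _ hee
      by_cases h0 : a e' = 0
      · rw [h0, zero_mul]
      · rw [hz e e.2 e' e'.2 (fun h => hee (Subtype.ext h)) (hmax e' (by simpa using h0)),
          mul_zero]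
    · simp
  simpa using hli.fintype_card_le_finrank

/-- The exponent of the monomial `x ^ i y ^ j z ^ k`. -/
noncomputable def ternaryExponent (i j k : ℕ) : Fin 3 →₀ ℕ :=
  Finsupp.equivFunOnFinite.symm ![i, j, k]

lemma ternaryExponent_degree (i j k : ℕ) : (ternaryExponent i j k).degree = i + j + k := by
  simp [Finsupp.degree_eq_sum, Fin.sum_univ_three, ternaryExponent]

lemma ternaryExponent_inj {i j k i' j' k' : ℕ} :
    ternaryExponent i j k = ternaryExponent i' j' k' ↔ i = i' ∧ j = j' ∧ k = k' := by
  simp [ternaryExponent]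

/-- The moments of a power sum decomposition of a ternary form: the set `A` collects the linear
forms `x + V y + W z` and `B` the linear forms `v y + w z`. -/
lemma HasWaringLength.exists_moments {d r : ℕ} {F : MvPolynomial (Fin 3) ℂ}
    (h : HasWaringLength d F r) :
    ∃ (A B : Finset (Fin r)) (C V W c v w : Fin r → ℂ), A.card + B.card = r ∧
      ∀ j k, j + k ≤ d → coeff (ternaryExponent (d - (j + k)) j k) F =
        (ternaryExponent (d - (j + k)) j k).multinomial *
          (∑ i ∈ A, C i * V i ^ j * W i ^ k +
            if j + k = d then ∑ i ∈ B, c i * v i ^ j * w i ^ k else 0) := by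
  obtain ⟨c, l, hl, rfl⟩ := h
  set p : Fin r → Fin 3 → ℂ := fun i j => coeff (Finsupp.single j 1) (l i) with hp
  have hlp : ∀ i, l i = ∑ j, p i j • X j := fun i => sum_smul_X_eq_of_isHomogeneous_one (hl i)
  refine ⟨Finset.univ.filter fun i => p i 0 ≠ 0, Finset.univ.filter fun i => ¬ p i 0 ≠ 0,
    fun i => c i * p i 0 ^ d, fun i => p i 1 / p i 0, fun i => p i 2 / p i 0, c,
    fun i => p i 1, fun i => p i 2, ?_, fun j k hjk => ?_⟩
  · rw [Finset.card_filter_add_card_filter_not, Finset.card_univ, Fintype.card_fin]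
  · simp only [hlp]
    rw [coeff_sum_smul_pow _ _ (by rw [ternaryExponent_degree]; omega)]
    congr 1
    rw [← Finset.sum_filter_add_sum_filter_not Finset.univ (fun i => p i 0 ≠ 0)]
    simp only [Fin.prod_univ_three, ternaryExponent, Finsupp.equivFunOnFinite_symm_apply_apply,
      Matrix.cons_val]
    congr 1
    · refine Finset.sum_congr rfl fun i hi => ?_
      have h0 : p i 0 ≠ 0 := (Finset.mem_filter.1 hi).2
      obtain ⟨e, rfl⟩ := Nat.exists_eq_add_of_le hjk
      rw [Nat.add_sub_cancel_left, div_pow, div_pow, pow_add, pow_add]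
      field_simp
    · split_ifs with h
      · refine Finset.sum_congr rfl fun i hi => ?_
        rw [h, Nat.sub_self, pow_zero, one_mul, mul_assoc]
      · refine Finset.sum_eq_zero fun i hi => ?_
        have h0 : p i 0 = 0 := not_not.1 (Finset.mem_filter.1 hi).2
        rw [h0, zero_pow (by omega)]
        ring

/-- Each divisor of `V^m W^n` is paired with its complementary divisor, weighted by `C`. -/
lemma box_card_le {ι : Type*} (A : Finset ι) (C V W : ι → ℂ) (m n : ℕ)
    (hne : ∑ i ∈ A, C i * V i ^ m * W i ^ n ≠ 0)
    (hz : ∀ j k, j + k ≤ m + n → ¬ (j = m ∧ k = n) → ∑ i ∈ A, C i * V i ^ j * W i ^ k = 0) :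
    (m + 1) * (n + 1) ≤ A.card := by
  have h := card_le_card_of_triangular (Finset.range (m + 1) ×ˢ Finset.range (n + 1)) A
    (fun e => e.1 + e.2) (fun e i => V i ^ e.1 * W i ^ e.2)
    (fun e i => C i * V i ^ (m - e.1) * W i ^ (n - e.2)) ?_ ?_
  · simpa using h
  all_goals
    have hcomb : ∀ e e' : ℕ × ℕ, ∑ i ∈ A, C i * V i ^ (m - e.1) * W i ^ (n - e.2) *
        (V i ^ e'.1 * W i ^ e'.2) =
        ∑ i ∈ A, C i * V i ^ (m - e.1 + e'.1) * W i ^ (n - e.2 + e'.2) :=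
      fun e e' => Finset.sum_congr rfl fun i _ => by ring
  · rintro ⟨j, k⟩ he
    simp only [Finset.mem_product, Finset.mem_range] at he
    rw [hcomb, show m - j + j = m by omega, show n - k + k = n by omega]
    exact hne
  · rintro ⟨j, k⟩ he ⟨j', k'⟩ he' hn hle
    simp only [Finset.mem_product, Finset.mem_range] at he he'
    simp only [ne_eq, Prod.mk.injEq] at hn hle
    rw [hcomb]
    exact hz _ _ (by simp only; omega) (by simp only; omega)

lemma le_waringLength_balanced_monomial {a r : ℕ}
    (h : HasWaringLength (2 * a + 1) (monomial (ternaryExponent 1 a a) (1 : ℂ)) r) :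
    (a + 1) ^ 2 ≤ r := by
  obtain ⟨A, B, C, V, W, c, v, w, hcard, hM⟩ := h.exists_moments
  have key : (a + 1) * (a + 1) ≤ A.card := by
    refine box_card_le A C V W a a (fun h0 => ?_) fun j k hjk hn => ?_
    · have h1 := hM a a (by omega)
      rw [h0, if_neg (by omega), coeff_monomial, if_pos (by rw [ternaryExponent_inj]; omega)] at h1
      simp at h1
    · have h1 := hM j k (by omega)
      rw [if_neg (by omega), coeff_monomial, if_neg (by rw [ternaryExponent_inj]; omega)] at h1
      simpa using (mul_eq_zero.1 h1.symm).resolve_left (multinomial_cast_ne_zero _)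
  rw [pow_two]
  omega

/-! ### A form of rank above the monomial maximum -/

/-- The form `x y ^ (b + 2) z ^ b + y z ^ (2 b + 2)` of degree `2 b + 3`. -/
noncomputable def highRankForm (b : ℕ) : MvPolynomial (Fin 3) ℂ :=
  monomial (ternaryExponent 1 (b + 2) b) 1 + monomial (ternaryExponent 0 1 (2 * b + 2)) 1

lemma highRankForm_isHomogeneous (b : ℕ) : (highRankForm b).IsHomogeneous (2 * b + 3) :=
  (isHomogeneous_monomial _ (by rw [ternaryExponent_degree]; omega)).add
    (isHomogeneous_monomial _ (by rw [ternaryExponent_degree]; omega))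

/-- A nonzero top moment lets `W^(b+1)` join the box. No moment with `W`-exponent above `b` and
total degree at most `2 * b + 2` survives. -/
lemma box_insert_card_le {ι : Type*} (A : Finset ι) (C V W : ι → ℂ) (b : ℕ)
    (hne : ∑ i ∈ A, C i * V i ^ (b + 2) * W i ^ b ≠ 0)
    (hz : ∀ j k, j + k ≤ 2 * b + 2 → ¬ (j = b + 2 ∧ k = b) →
      ∑ i ∈ A, C i * V i ^ j * W i ^ k = 0)
    {p : ℕ} (hp : p ≤ 1) (hne' : ∑ i ∈ A, C i * V i ^ p * W i ^ (2 * b + 3 - p) ≠ 0) :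
    (b + 2) ^ 2 ≤ A.card := by
  have hbox : ∀ e e' : ℕ × ℕ, ∑ i ∈ A, C i * V i ^ (b + 2 - e.1) * W i ^ (b - e.2) *
      (V i ^ e'.1 * W i ^ e'.2) =
      ∑ i ∈ A, C i * V i ^ (b + 2 - e.1 + e'.1) * W i ^ (b - e.2 + e'.2) :=
    fun e e' => Finset.sum_congr rfl fun i _ => by ring
  have htop : ∀ e' : ℕ × ℕ, ∑ i ∈ A, C i * V i ^ p * W i ^ (b + 2 - p) *
      (V i ^ e'.1 * W i ^ e'.2) =
      ∑ i ∈ A, C i * V i ^ (p + e'.1) * W i ^ (b + 2 - p + e'.2) :=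
    fun e' => Finset.sum_congr rfl fun i _ => by ring
  have h := card_le_card_of_triangular
    (insert (0, b + 1) (Finset.range (b + 3) ×ˢ Finset.range (b + 1))) A
    -- This ranks `W^(b+1)` strictly between the box monomials of degree `b` and those of degree `b
    -- + 1`, keeping the off-diagonal moments in degree at most `2 * b + 2`, where they are known.
    (fun e => if e.2 = b + 1 then 2 * b + 2 else 2 * (e.1 + e.2) + 1)
    (fun e i => V i ^ e.1 * W i ^ e.2)
    (fun e i => if e.2 = b + 1 then C i * V i ^ p * W i ^ (b + 2 - p)
      else C i * V i ^ (b + 2 - e.1) * W i ^ (b - e.2)) ?_ ?_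
  · rw [Finset.card_insert_of_notMem (by simp), Finset.card_product, Finset.card_range,
      Finset.card_range] at h
    nlinarith
  · rintro ⟨j, k⟩ he
    simp only [Finset.mem_insert, Finset.mem_product, Finset.mem_range, Prod.mk.injEq] at he
    dsimp only
    split_ifs with hk
    · rw [htop (j, k)]
      dsimp only
      rw [show p + j = p by omega, show b + 2 - p + k = 2 * b + 3 - p by omega]
      exact hne'
    · rw [hbox (j, k) (j, k)]
      dsimp only
      rw [show b + 2 - j + j = b + 2 by omega, show b - k + k = b by omega]
      exact hne
  · rintro ⟨j, k⟩ he ⟨j', k'⟩ he' hn hle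
    simp only [Finset.mem_insert, Finset.mem_product, Finset.mem_range, Prod.mk.injEq] at he he'
    simp only [ne_eq, Prod.mk.injEq] at hn hle
    dsimp only
    split_ifs at hle ⊢ with hk
    · omega
    · rw [htop (j', k')]
      exact hz _ _ (by simp only; omega) (by simp only; omega)
    all_goals
      rw [hbox (j, k) (j', k')]
      exact hz _ _ (by simp only; omega) (by simp only; omega)

/-- With the degree `2 * b + 3` moments also known, `W^(b+1)` and `V W^(b+1)` both join the box,
dual to each other through `V W^(2b+2)`. -/
lemma box_insert_insert_card_le {ι : Type*} (A : Finset ι) (C V W : ι → ℂ) (b : ℕ)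
    (hne : ∑ i ∈ A, C i * V i ^ (b + 2) * W i ^ b ≠ 0)
    (hne' : ∑ i ∈ A, C i * V i ^ 1 * W i ^ (2 * b + 2) ≠ 0)
    (hz : ∀ j k, j + k ≤ 2 * b + 3 → ¬ (j = b + 2 ∧ k = b) → ¬ (j = 1 ∧ k = 2 * b + 2) →
      ∑ i ∈ A, C i * V i ^ j * W i ^ k = 0) :
    (b + 2) ^ 2 < A.card := by
  have hbox : ∀ e e' : ℕ × ℕ, ∑ i ∈ A, C i * V i ^ (b + 2 - e.1) * W i ^ (b - e.2) *
      (V i ^ e'.1 * W i ^ e'.2) =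
      ∑ i ∈ A, C i * V i ^ (b + 2 - e.1 + e'.1) * W i ^ (b - e.2 + e'.2) :=
    fun e e' => Finset.sum_congr rfl fun i _ => by ring
  have htop : ∀ e e' : ℕ × ℕ, ∑ i ∈ A, C i * V i ^ (1 - e.1) * W i ^ (b + 1) *
      (V i ^ e'.1 * W i ^ e'.2) =
      ∑ i ∈ A, C i * V i ^ (1 - e.1 + e'.1) * W i ^ (b + 1 + e'.2) :=
    fun e e' => Finset.sum_congr rfl fun i _ => by ring
  have h := card_le_card_of_triangular
    (insert (0, b + 1) (insert (1, b + 1) (Finset.range (b + 3) ×ˢ Finset.range (b + 1)))) A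
    (fun e => e.1 + e.2) (fun e i => V i ^ e.1 * W i ^ e.2)
    (fun e i => if e.2 = b + 1 then C i * V i ^ (1 - e.1) * W i ^ (b + 1)
      else C i * V i ^ (b + 2 - e.1) * W i ^ (b - e.2)) ?_ ?_
  · rw [Finset.card_insert_of_notMem (by simp), Finset.card_insert_of_notMem (by simp),
      Finset.card_product, Finset.card_range, Finset.card_range] at h
    nlinarith
  · rintro ⟨j, k⟩ he
    simp only [Finset.mem_insert, Finset.mem_product, Finset.mem_range, Prod.mk.injEq] at he
    dsimp only
    split_ifs with hk
    · rw [htop (j, k) (j, k)]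
      dsimp only
      rw [show 1 - j + j = 1 by omega, show b + 1 + k = 2 * b + 2 by omega]
      exact hne'
    · rw [hbox (j, k) (j, k)]
      dsimp only
      rw [show b + 2 - j + j = b + 2 by omega, show b - k + k = b by omega]
      exact hne
  · rintro ⟨j, k⟩ he ⟨j', k'⟩ he' hn hle
    simp only [Finset.mem_insert, Finset.mem_product, Finset.mem_range, Prod.mk.injEq] at he he'
    simp only [ne_eq, Prod.mk.injEq] at hn hle
    dsimp only
    split_ifs with hk
    · rw [htop (j, k) (j', k')]
      exact hz _ _ (by simp only; omega) (by simp only; omega) (by simp only; omega)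
    · rw [hbox (j, k) (j', k')]
      exact hz _ _ (by simp only; omega) (by simp only; omega) (by simp only; omega)

lemma lt_waringLength_highRankForm {b r : ℕ}
    (h : HasWaringLength (2 * b + 3) (highRankForm b) r) : (b + 2) ^ 2 < r := by
  obtain ⟨A, B, C, V, W, c, v, w, hcard, hM⟩ := h.exists_moments
  by_contra! hr
  have hlow : ∑ i ∈ A, C i * V i ^ (b + 2) * W i ^ b ≠ 0 := fun h0 => by
    have h1 := hM (b + 2) b (by omega)
    rw [h0, if_neg (by omega), highRankForm, coeff_add, coeff_monomial, coeff_monomial,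
      if_pos (by rw [ternaryExponent_inj]; omega),
      if_neg (by rw [ternaryExponent_inj]; omega)] at h1
    simp at h1
  have hzero : ∀ j k, j + k ≤ 2 * b + 2 → ¬ (j = b + 2 ∧ k = b) →
      ∑ i ∈ A, C i * V i ^ j * W i ^ k = 0 := fun j k hjk hn => by
    have h1 := hM j k (by omega)
    rw [if_neg (by omega), highRankForm, coeff_add, coeff_monomial, coeff_monomial,
      if_neg (by rw [ternaryExponent_inj]; omega),
      if_neg (by rw [ternaryExponent_inj]; omega)] at h1
    simpa using (mul_eq_zero.1 (h1.symm.trans (add_zero _))).resolve_left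
      (multinomial_cast_ne_zero _)
  have htop : ∑ i ∈ A, C i * V i ^ 1 * W i ^ (2 * b + 2) +
      ∑ i ∈ B, c i * v i ^ 1 * w i ^ (2 * b + 2) ≠ 0 := fun h0 => by
    have h1 := hM 1 (2 * b + 2) (by omega)
    rw [if_pos (by omega), h0, highRankForm, coeff_add, coeff_monomial, coeff_monomial,
      if_neg (by rw [ternaryExponent_inj]; omega),
      if_pos (by rw [ternaryExponent_inj]; omega)] at h1
    simp at h1
  have hzero' : ∀ j k, j + k = 2 * b + 3 → ¬ (j = 1 ∧ k = 2 * b + 2) →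
      ∑ i ∈ A, C i * V i ^ j * W i ^ k + ∑ i ∈ B, c i * v i ^ j * w i ^ k = 0 :=
    fun j k hjk hn => by
      have h1 := hM j k (by omega)
      rw [if_pos (by omega), highRankForm, coeff_add, coeff_monomial, coeff_monomial,
        if_neg (by rw [ternaryExponent_inj]; omega),
        if_neg (by rw [ternaryExponent_inj]; omega)] at h1
      exact (mul_eq_zero.1 (h1.symm.trans (add_zero _))).resolve_left
        (multinomial_cast_ne_zero _)
  have hA : (b + 2 + 1) * (b + 1) ≤ A.card :=
    box_card_le A C V W (b + 2) b hlow fun j k hjk => hzero j k (by omega)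
  have hB : B.card ≤ 1 := by nlinarith
  rcases Nat.le_one_iff_eq_zero_or_eq_one.1 hB with hB | hB
  · rw [Finset.card_eq_zero] at hB
    subst hB
    simp only [Finset.sum_empty, add_zero] at htop hzero'
    have := box_insert_insert_card_le A C V W b hlow htop fun j k hjk h1 h2 =>
      (Nat.lt_or_ge (j + k) (2 * b + 3)).elim (fun hd => hzero j k (by omega) h1)
        fun hd => hzero' j k (by omega) h2
    omega
  · obtain ⟨i₀, rfl⟩ := Finset.card_eq_one.1 hB
    simp only [Finset.sum_singleton] at htop hzero'
    have hlt : ¬ (b + 2) ^ 2 ≤ A.card := by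
      rw [Finset.card_singleton] at hcard
      omega
    have h1 : ∑ i ∈ A, C i * V i ^ 1 * W i ^ (2 * b + 2) = 0 := by
      by_contra hne
      exact hlt (box_insert_card_le A C V W b hlow hzero le_rfl hne)
    have h0 : ∑ i ∈ A, C i * V i ^ 0 * W i ^ (2 * b + 3) = 0 := by
      by_contra hne
      exact hlt (box_insert_card_le A C V W b hlow hzero zero_le_one hne)
    have h2 := hzero' 0 (2 * b + 3) (by omega) (by omega)
    -- The `z^d` coefficient now forces `c i₀ = 0` or `w i₀ = 0`, which also kills the contribution
    -- to `y z^(d-1)`.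
    rw [h0, zero_add, pow_zero, mul_one, mul_eq_zero, pow_eq_zero_iff (by omega)] at h2
    rw [h1, zero_add] at htop
    rcases h2 with h2 | h2 <;> exact htop (by simp [h2])

theorem mainTheorem2 (d : ℕ) (hd : 3 ≤ d) (hodd : Odd d) :
    IsGreatest (monomialWaringRanks 3 d) (((d + 1) / 2) ^ 2) ∧
    (∃ F : MvPolynomial (Fin 3) ℂ, F.IsHomogeneous d ∧ ((d + 1) / 2) ^ 2 < waringRank d F) ∧
    IsGreatest (waringRanks 3 d) (maxWaringRank 3 d) ∧
    ((d + 1) / 2) ^ 2 < maxWaringRank 3 d := by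
  obtain ⟨b, rfl⟩ : ∃ b, d = 2 * b + 3 := by
    obtain ⟨a, rfl⟩ := hodd
    exact ⟨a - 1, by omega⟩
  rw [show (2 * b + 3 + 1) / 2 = b + 2 by omega]
  obtain ⟨N, hN⟩ := exists_hasWaringLength_bound (a := b + 1) (by omega)
  have hhigh : (b + 2) ^ 2 < waringRank (2 * b + 3) (highRankForm b) :=
    lt_waringLength_highRankForm (hN _ (highRankForm_isHomogeneous b)).waringRank_self
  have hbdd : BddAbove (waringRanks 3 (2 * b + 3)) :=
    ⟨N, by rintro _ ⟨F, hF, rfl⟩; exact (hN F hF).waringRank_le⟩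
  have hmem : waringRank (2 * b + 3) (highRankForm b) ∈ waringRanks 3 (2 * b + 3) :=
    ⟨_, highRankForm_isHomogeneous b, rfl⟩
  refine ⟨⟨⟨ternaryExponent 1 (b + 1) (b + 1), ?_, ?_⟩, ?_⟩,
    ⟨_, highRankForm_isHomogeneous b, hhigh⟩,
    ⟨Nat.sSup_mem ⟨_, hmem⟩ hbdd, fun r hr => le_csSup hbdd hr⟩,
    hhigh.trans_le (le_csSup hbdd hmem)⟩
  · rw [ternaryExponent_degree]; omega
  · have h := hasWaringLength_monomial_three (a := b + 1) (by omega)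
      (ternaryExponent 1 (b + 1) (b + 1)) (by rw [ternaryExponent_degree]; omega)
    exact le_antisymm h.waringRank_le (le_waringLength_balanced_monomial h.waringRank_self)
  · rintro _ ⟨m, hm, rfl⟩
    exact (hasWaringLength_monomial_three (a := b + 1) (by omega) m hm).waringRank_le
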